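/- For real numbers $\alpha,\beta$ let $S(\alpha,\beta)=\{\lfloor \alpha n+\beta\rfloor : n\in\mathbb{Z}\}$ be the Beatty sequence with modulus $\alpha$. Let $p,q_1,q_2,q_3,q_4$ be positive integers with $\gcd(p,q_i)=1$ for $i=1,\dots,4$, and let $\beta_1,\dots,\beta_4$ be real numbers. Suppose that every integer belongs to exactly one of the four sequences $S(p/q_i,\beta_i)$, $i=1,\dots,4$, and that the moduli $p/q_1,\dots,p/q_4$ are pairwise distinct. Then $p=15$ and $\{q_1,q_2,q_3,q_4\}=\{8,4,2,1\}$. -/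

import Mathlib

/-- The (two-sided, inhomogeneous) Beatty sequence `S(α, β) = {⌊α n + β⌋ : n ∈ ℤ}` with
modulus `α`, as a set of integers. -/
noncomputable def beattyS (α β : ℝ) : Set ℤ :=
  Set.range fun n : ℤ => ⌊α * (n : ℝ) + β⌋

/-- The Beatty sequences `S(α i, β i)`, `i ∈ ι`, form a disjoint covering system: every integer
belongs to exactly one of them. -/
def IsBeattyDCS {ι : Type*} (α β : ι → ℝ) : Prop :=
  ∀ m : ℤ, ∃! i : ι, m ∈ beattyS (α i) (β i)

/-! The indicator of `S(p/q, β)` is `p`-periodic, and multiplication by `q` turns it into that of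
`q` consecutive residues. Its Fourier coefficient at `k` is therefore a geometric sum, of absolute
value `|sin(πk/p)| / |sin(πkq⁻¹/p)|` for `k ≠ 0`. In a covering system these coefficients cancel at
`k ≠ 0`.

At `k = q i` the triangle inequality reads `1/sin(π/p) ≤ ∑_{j≠i} 1/sin(π m_j/p)`, where `m_j` is the
least absolute residue of `q i / q j` (`IsBeattyDCS.inv_sin_le`). The `m_j` are distinct and at
least 2. If all were at least 3, the right side would be too small, roughly because `1/3 + 1/4 + 1/5
< 1` (`inv_sin_sum_lt`). Hence `q i ≡ ±2 q j` for some `j`.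

Following these links around a cycle gives `2^l ≡ ±1` mod `p` with `l ≤ 4`. Since `p = ∑ q i ≥ 11`,
only 15 and 17 remain, and a finite check finishes. -/

/-! ### Beatty sequences modulo `p` and their Fourier coefficients -/

/-- The indicator of a Beatty sequence of modulus `p / q`, read modulo `p`. -/
theorem mem_beattyS_iff {p q : ℕ} [NeZero p] (hq : 0 < q) (β : ℝ) (m : ℤ) :
    m ∈ beattyS ((p : ℝ) / q) β ↔ ((⌊(q : ℝ) * β⌋ : ZMod p) - (q : ZMod p) * m).val < q := by
  have hq' : (0 : ℝ) < q := by exact_mod_cast hq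
  have hp : 0 < p := Nat.pos_of_ne_zero (NeZero.ne p)
  set b : ℤ := ⌊(q : ℝ) * β⌋ with hb
  have key : ∀ n : ℤ, ⌊(p : ℝ) / q * n + β⌋ = m ↔
      0 ≤ p * n + (b - q * m) ∧ p * n + (b - q * m) < q := by
    intro n
    have e : (p : ℝ) / q * n + β = (p * n + q * β) / q := by field_simp
    rw [Int.floor_eq_iff, e, le_div_iff₀ hq', div_lt_iff₀ hq']
    have h1 : (m : ℝ) * q ≤ p * n + q * β ↔ m * q - p * n ≤ b := by
      rw [hb, Int.le_floor]; push_cast; constructor <;> intro h <;> linarith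
    have h2 : (p : ℝ) * n + q * β < (m + 1) * q ↔ b < (m + 1) * q - p * n := by
      rw [hb, Int.floor_lt]; push_cast; constructor <;> intro h <;> linarith
    rw [h1, h2]
    constructor <;> rintro ⟨h, h'⟩ <;> constructor <;> linarith
  have hval : (((b : ZMod p) - (q : ZMod p) * m).val : ℤ) = (b - q * m) % p := by
    rw [← ZMod.val_intCast]; push_cast; rfl
  have hp' : (0 : ℤ) < p := by exact_mod_cast hp
  have hmod := Int.emod_add_mul_ediv (b - q * m) p
  have hnn := Int.emod_nonneg (b - q * m) hp'.ne'
  constructor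
  · rintro ⟨n, hn⟩
    obtain ⟨h0, h1⟩ := (key n).1 hn
    -- The residue is the least nonnegative member of its class, so `q < p` is not needed.
    have : (b - q * m) % p ≤ p * n + (b - q * m) := by
      have hdiv : 0 ≤ (p * n + (b - q * m)) / p := Int.ediv_nonneg h0 hp'.le
      rw [add_comm, Int.add_mul_ediv_left _ _ hp'.ne'] at hdiv
      nlinarith
    zify
    rw [hval]
    exact this.trans_lt h1
  · intro h
    zify at h
    rw [hval] at h
    refine ⟨-((b - q * m) / p), (key _).2 ?_⟩
    constructor <;> linarith

/-- The Fourier transform of a Beatty sequence of modulus `p / q`. -/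
theorem sum_beatty_addChar {p q : ℕ} [NeZero p] (hqp : q < p) (hc : Nat.Coprime p q)
    (b : ZMod p) (ψ : AddChar (ZMod p) ℂ) (k : ZMod p) :
    ∑ x : ZMod p, (if (b - (q : ZMod p) * x).val < q then ψ (k * x) else 0) =
      ψ (k * (b * (q : ZMod p)⁻¹)) *
        ∑ r ∈ Finset.range q, ψ (-(k * (q : ZMod p)⁻¹)) ^ r := by
  have hinv : (q : ZMod p) * (q : ZMod p)⁻¹ = 1 := ZMod.coe_mul_inv_eq_one q hc.symm
  have h1 : ∑ x : ZMod p, (if (b - (q : ZMod p) * x).val < q then ψ (k * x) else 0) =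
      -- The substitution `y = b - q x` turns the support into the interval `0 ≤ y < q`.
      ∑ y : ZMod p, (if y.val < q then ψ (k * ((b - y) * (q : ZMod p)⁻¹)) else 0) := by
    refine Finset.sum_nbij' (fun x => b - (q : ZMod p) * x) (fun y => (b - y) * (q : ZMod p)⁻¹)
      (by simp) (by simp) ?_ ?_ ?_
    · intro x _
      linear_combination x * hinv
    · intro y _
      linear_combination (y - b) * hinv
    · intro x _
      have : (b - (b - (q : ZMod p) * x)) * (q : ZMod p)⁻¹ = x := by
        linear_combination x * hinv
      simp only [this]
  rw [h1, ← Finset.sum_filter, Finset.mul_sum]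
  refine Finset.sum_nbij' (fun y => y.val) (fun r => (r : ZMod p)) ?_ ?_ ?_ ?_ ?_
  · intro y hy
    simpa using hy
  · intro r hr
    have hr' := Finset.mem_range.1 hr
    simp [ZMod.val_natCast_of_lt (hr'.trans hqp), hr']
  · intro y _
    simp
  · intro r hr
    exact ZMod.val_natCast_of_lt ((Finset.mem_range.1 hr).trans hqp)
  · intro y _
    rw [← AddChar.map_nsmul_eq_pow, ← AddChar.map_add_eq_mul]
    congr 1
    rw [nsmul_eq_mul, ZMod.natCast_zmod_val]
    ring

/-- The geometric sum of ratio `z = ψ(-k q⁻¹)` telescopes against `1 - z`, and `z ^ q = ψ(-k)`. The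
product form avoids dividing by zero at `k = 0`. -/
theorem norm_sum_beatty_addChar {p q : ℕ} [NeZero p] (hqp : q < p) (hc : Nat.Coprime p q)
    (b : ZMod p) (k : ZMod p) :
    ‖∑ x : ZMod p, (if (b - (q : ZMod p) * x).val < q then
        (ZMod.stdAddChar (k * x) : ℂ) else 0)‖ *
      ‖(1 : ℂ) - ZMod.stdAddChar (-(k * (q : ZMod p)⁻¹))‖ =
      ‖(1 : ℂ) - ZMod.stdAddChar (-k)‖ := by
  have hinv : (q : ZMod p) * (q : ZMod p)⁻¹ = 1 := ZMod.coe_mul_inv_eq_one q hc.symm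
  rw [sum_beatty_addChar hqp hc, norm_mul, AddChar.norm_apply, one_mul, ← norm_mul,
    geom_sum_mul_neg, ← AddChar.map_nsmul_eq_pow]
  congr 4
  rw [nsmul_eq_mul]
  linear_combination (-k) * hinv

theorem norm_one_sub_stdAddChar_neg {p : ℕ} [NeZero p] (x : ZMod p) :
    ‖(1 : ℂ) - ZMod.stdAddChar (-x)‖ = 2 * Real.sin (Real.pi / p * x.valMinAbs.natAbs) := by
  have hp : (0 : ℝ) < p := by exact_mod_cast Nat.pos_of_ne_zero (NeZero.ne p)
  have hle : (x.valMinAbs.natAbs : ℝ) ≤ p := by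
    exact_mod_cast (ZMod.natAbs_valMinAbs_le x).trans (Nat.div_le_self _ _)
  have hs : 0 ≤ Real.sin (Real.pi / p * x.valMinAbs.natAbs) := by
    apply Real.sin_nonneg_of_nonneg_of_le_pi (by positivity)
    rw [div_mul_eq_mul_div, div_le_iff₀ hp]
    exact mul_le_mul_of_nonneg_left hle Real.pi_pos.le
  have hx : -x = ((-x.valMinAbs : ℤ) : ZMod p) := by simp
  rw [hx, ZMod.stdAddChar_coe, norm_sub_rev,
    show 2 * (Real.pi : ℂ) * Complex.I * ((-x.valMinAbs : ℤ) : ℂ) / p =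
      Complex.I * ((2 * (Real.pi / p * (-x.valMinAbs : ℝ)) : ℝ) : ℂ) by push_cast; ring,
    Complex.norm_exp_I_mul_ofReal_sub_one, mul_div_cancel_left₀ _ two_ne_zero, mul_neg,
    Real.sin_neg, mul_neg, norm_neg, Real.norm_eq_abs, abs_mul, abs_two]
  congr 1
  rw [← abs_of_nonneg hs, Nat.cast_natAbs, Int.cast_abs]
  rcases abs_choice (x.valMinAbs : ℝ) with h | h <;> rw [h]
  rw [mul_neg, Real.sin_neg, abs_neg]

/-! ### Sine estimates -/

/-- The ratios `sin(kt)/sin t` decrease in `t` on this range; the constants lie below their values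
at `π/11`. -/
theorem sin_lower_bounds {t : ℝ} (h0 : 0 < t) (h1 : t ≤ Real.pi / 11) :
    2.67 * Real.sin t ≤ Real.sin (t * 3) ∧ 3.15 * Real.sin t ≤ Real.sin (t * 4) ∧
      3.36 * Real.sin t ≤ Real.sin (t * 5) := by
  have hpi := Real.pi_lt_d4
  have ht : t < 0.2856 := by linarith
  have hs : 0 < Real.sin t := Real.sin_pos_of_pos_of_lt_pi h0 (by linarith [Real.pi_gt_three])
  have hst : Real.sin t < 0.2856 := (Real.sin_lt h0).trans ht
  have hc : 0 < Real.cos t :=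
    Real.cos_pos_of_mem_Ioo ⟨by linarith [Real.pi_gt_three], by linarith [Real.pi_gt_three]⟩
  have hsq := Real.sin_sq_add_cos_sq t
  set s := Real.sin t with hsdef
  set c := Real.cos t with hcdef
  have hs2 : s ^ 2 < 0.0816 := by nlinarith
  have hc2 : c ^ 2 = 1 - s ^ 2 := by linarith
  have hcl : 0.95 ≤ c := by nlinarith
  have e2 : Real.sin (2 * t) = 2 * s * c := Real.sin_two_mul t
  have e2' : Real.cos (2 * t) = 1 - 2 * s ^ 2 := by rw [Real.cos_two_mul, ← hcdef, hc2]; ring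
  have e3 : Real.sin (3 * t) = 3 * s - 4 * s ^ 3 := Real.sin_three_mul t
  have e4 : Real.sin (t * 4) = 4 * (s * c) * (1 - 2 * s ^ 2) := by
    rw [show t * 4 = 2 * (2 * t) by ring, Real.sin_two_mul, e2, e2']; ring
  have e5 : Real.sin (t * 5) = s * (5 - 20 * s ^ 2 + 16 * s ^ 4) := by
    have e3' : Real.cos (3 * t) = 4 * c ^ 3 - 3 * c := Real.cos_three_mul t
    rw [show t * 5 = 2 * t + 3 * t by ring, Real.sin_add, e2, e2', e3, e3']
    linear_combination (8 * s * c ^ 2 + 8 * s * (1 - s ^ 2) - 6 * s) * hc2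
  refine ⟨?_, ?_, ?_⟩
  · rw [mul_comm t, e3]
    have : 2.67 * s ≤ s * (3 - 4 * s ^ 2) := by
      rw [mul_comm]; exact mul_le_mul_of_nonneg_left (by linarith) hs.le
    linarith
  · rw [e4]
    have : 3.15 ≤ 4 * c * (1 - 2 * s ^ 2) := by nlinarith
    have := mul_le_mul_of_nonneg_left this hs.le
    linarith
  · rw [e5, mul_comm]
    exact mul_le_mul_of_nonneg_left (by nlinarith [pow_nonneg hs.le 4]) hs.le

/-- Three distinct multiples, each at least three, of a small angle do not have large reciprocal
sines. -/
theorem inv_sin_sum_lt {p : ℕ} (hp : 11 ≤ p) {a b c : ℕ} (ha : 3 ≤ a) (hb : 3 ≤ b) (hc : 3 ≤ c)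
    (ha' : a ≤ p / 2) (hb' : b ≤ p / 2) (hc' : c ≤ p / 2) (hab : a ≠ b) (hac : a ≠ c)
    (hbc : b ≠ c) :
    (Real.sin (Real.pi / p * a))⁻¹ + (Real.sin (Real.pi / p * b))⁻¹ +
      (Real.sin (Real.pi / p * c))⁻¹ < (Real.sin (Real.pi / p))⁻¹ := by
  have hp0 : (0 : ℝ) < p := by exact_mod_cast (by omega : 0 < p)
  set t := Real.pi / p with ht
  have ht0 : 0 < t := div_pos Real.pi_pos hp0
  have ht1 : t ≤ Real.pi / 11 :=
    div_le_div_of_nonneg_left Real.pi_pos.le (by norm_num) (by exact_mod_cast hp)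
  have hs : 0 < Real.sin t :=
    Real.sin_pos_of_pos_of_lt_pi ht0 (by linarith [Real.pi_pos])
  have mono : ∀ {m n : ℕ}, m ≤ n → n ≤ p / 2 → Real.sin (t * m) ≤ Real.sin (t * n) := by
    intro m n hmn hn
    have hn' : (2 * n : ℝ) ≤ p := by exact_mod_cast (by omega : 2 * n ≤ p)
    have htn : t * n ≤ Real.pi / 2 := by
      rw [ht, div_mul_eq_mul_div, div_le_iff₀ hp0]
      nlinarith [Real.pi_pos]
    have hm0 : 0 ≤ t * m := by positivity
    apply Real.sin_le_sin_of_le_of_le_pi_div_two (by linarith [Real.pi_pos]) htn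
    exact mul_le_mul_of_nonneg_left (by exact_mod_cast hmn) ht0.le
  obtain ⟨h3, h4, h5⟩ := sin_lower_bounds ht0 ht1
  set u := (Real.sin t)⁻¹ with hu
  have hu0 : 0 < u := inv_pos.2 hs
  have step : ∀ {C : ℝ}, 0 < C → ∀ {k n : ℕ}, C * Real.sin t ≤ Real.sin (t * k) → k ≤ n →
      n ≤ p / 2 → (Real.sin (t * n))⁻¹ ≤ C⁻¹ * u := by
    intro C hC k n hk hkn hn
    rw [hu, ← mul_inv]
    exact inv_anti₀ (mul_pos hC hs) (hk.trans (mono hkn hn))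
  -- The three factors are reciprocals rounded up; their sum 0.991 is below 1.
  have b3 : ∀ n : ℕ, 3 ≤ n → n ≤ p / 2 → (Real.sin (t * n))⁻¹ ≤ 0.375 * u := fun n h h' =>
    (step (C := 2.67) (k := 3) (by norm_num) (by simpa using h3) h h').trans
      (mul_le_mul_of_nonneg_right (by norm_num) hu0.le)
  have b4 : ∀ n : ℕ, 4 ≤ n → n ≤ p / 2 → (Real.sin (t * n))⁻¹ ≤ 0.318 * u := fun n h h' =>
    (step (C := 3.15) (k := 4) (by norm_num) (by simpa using h4) h h').trans
      (mul_le_mul_of_nonneg_right (by norm_num) hu0.le)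
  have b5 : ∀ n : ℕ, 5 ≤ n → n ≤ p / 2 → (Real.sin (t * n))⁻¹ ≤ 0.298 * u := fun n h h' =>
    (step (C := 3.36) (k := 5) (by norm_num) (by simpa using h5) h h').trans
      (mul_le_mul_of_nonneg_right (by norm_num) hu0.le)
  rcases lt_or_gt_of_ne hab with h1 | h1 <;> rcases lt_or_gt_of_ne hac with h2 | h2 <;>
    rcases lt_or_gt_of_ne hbc with h3 | h3
  · linarith [b3 a ha ha', b4 b (by omega) hb', b5 c (by omega) hc']
  · linarith [b3 a ha ha', b5 b (by omega) hb', b4 c (by omega) hc']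
  · omega
  · linarith [b4 a (by omega) ha', b5 b (by omega) hb', b3 c hc hc']
  · linarith [b4 a (by omega) ha', b3 b hb hb', b5 c (by omega) hc']
  · omega
  · linarith [b5 a (by omega) ha', b3 b hb hb', b4 c (by omega) hc']
  · linarith [b5 a (by omega) ha', b4 b (by omega) hb', b3 c hc hc']

/-! ### Fourier analysis of disjoint covering systems -/

/-- A sequence of modulus at most 1 covers every integer and leaves none for another sequence. -/
theorem IsBeattyDCS.lt {ι : Type*} [Nontrivial ι] {p : ℕ} (hp : 0 < p) {q : ι → ℕ} {β : ι → ℝ}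
    (hq : ∀ i, 0 < q i) (h : IsBeattyDCS (fun i => (p : ℝ) / (q i : ℝ)) β) (i : ι) : q i < p := by
  have : NeZero p := ⟨hp.ne'⟩
  by_contra hle
  obtain ⟨j, hj⟩ := exists_ne i
  have hm : ⌊(p : ℝ) / (q j : ℝ) * ((0 : ℤ) : ℝ) + β j⌋ ∈ beattyS ((p : ℝ) / q j) (β j) := ⟨0, rfl⟩
  exact hj ((h _).unique hm
    ((mem_beattyS_iff (hq i) _ _).2 ((ZMod.val_lt _).trans_le (not_lt.1 hle))))

/-- The Fourier transforms of the members of a disjoint covering system add up to that of the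
constant function. -/
theorem IsBeattyDCS.sum_addChar {ι : Type*} [Fintype ι] {p : ℕ} [NeZero p] {q : ι → ℕ}
    {β : ι → ℝ} (hq : ∀ i, 0 < q i) (h : IsBeattyDCS (fun i => (p : ℝ) / (q i : ℝ)) β)
    (f : ZMod p → ℂ) :
    ∑ i, ∑ x : ZMod p, (if ((⌊(q i : ℝ) * β i⌋ : ZMod p) - (q i : ZMod p) * x).val < q i then
      f x else 0) = ∑ x, f x := by
  rw [Finset.sum_comm]
  refine Finset.sum_congr rfl fun x _ => ?_
  obtain ⟨m, rfl⟩ := ZMod.intCast_surjective x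
  obtain ⟨i, hi, hu⟩ := h m
  rw [Finset.sum_eq_single i]
  · exact if_pos ((mem_beattyS_iff (hq i) _ _).1 hi)
  · intro j _ hj
    exact if_neg fun hj' => hj (hu j ((mem_beattyS_iff (hq j) _ _).2 hj'))
  · simp

theorem IsBeattyDCS.sum_eq {ι : Type*} [Fintype ι] [Nontrivial ι] {p : ℕ} (hp : 0 < p)
    {q : ι → ℕ} {β : ι → ℝ} (hq : ∀ i, 0 < q i) (hc : ∀ i, Nat.Coprime p (q i))
    (h : IsBeattyDCS (fun i => (p : ℝ) / (q i : ℝ)) β) : ∑ i, q i = p := by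
  have : NeZero p := ⟨hp.ne'⟩
  -- Frequency zero counts the residues covered by each sequence.
  have key := h.sum_addChar hq (fun x => (ZMod.stdAddChar (0 * x) : ℂ))
  simp only [sum_beatty_addChar (h.lt hp hq _) (hc _)] at key
  simp at key
  exact_mod_cast key

/-- The triangle inequality for the Fourier coefficients at the frequency `q i`. -/
theorem IsBeattyDCS.inv_sin_le {ι : Type*} [Fintype ι] [DecidableEq ι] [Nontrivial ι] {p : ℕ}
    (hp : 1 < p) {q : ι → ℕ} {β : ι → ℝ} (hq : ∀ i, 0 < q i) (hc : ∀ i, Nat.Coprime p (q i))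
    (h : IsBeattyDCS (fun i => (p : ℝ) / (q i : ℝ)) β) (i : ι) :
    (Real.sin (Real.pi / p))⁻¹ ≤ ∑ j ∈ Finset.univ.erase i, (Real.sin (Real.pi / p *
      ((q i : ZMod p) * (q j : ZMod p)⁻¹).valMinAbs.natAbs))⁻¹ := by
  have : NeZero p := ⟨by omega⟩
  have : Fact (1 < p) := ⟨hp⟩
  have hinv : ∀ j, (q j : ZMod p) * (q j : ZMod p)⁻¹ = 1 :=
    fun j => ZMod.coe_mul_inv_eq_one _ (hc j).symm
  have hq0 : ∀ j, (q j : ZMod p) ≠ 0 := fun j h0 => by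
    have := hinv j
    rw [h0, zero_mul] at this
    exact zero_ne_one this
  have hsin : ∀ x : ZMod p, x ≠ 0 → 0 < 2 * Real.sin (Real.pi / p * x.valMinAbs.natAbs) := by
    intro x hx
    rw [← norm_one_sub_stdAddChar_neg, norm_pos_iff, sub_ne_zero]
    intro h1
    rw [← AddChar.map_zero_eq_one (ZMod.stdAddChar (N := p))] at h1
    exact hx (neg_eq_zero.1 (ZMod.injective_stdAddChar h1).symm)
  set S := fun x : ZMod p => Real.sin (Real.pi / p * x.valMinAbs.natAbs) with hS
  set F : ι → ℂ := fun j => ∑ x : ZMod p,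
    (if ((⌊(q j : ℝ) * β j⌋ : ZMod p) - (q j : ZMod p) * x).val < q j then
      (ZMod.stdAddChar ((q i : ZMod p) * x) : ℂ) else 0) with hF
  have hnorm : ∀ j, ‖F j‖ = S (q i) * (S ((q i : ZMod p) * (q j : ZMod p)⁻¹))⁻¹ := by
    intro j
    have h1 := norm_sum_beatty_addChar (h.lt (by omega) hq j) (hc j)
      (⌊(q j : ℝ) * β j⌋ : ZMod p) (q i : ZMod p)
    rw [norm_one_sub_stdAddChar_neg, norm_one_sub_stdAddChar_neg] at h1
    have hne : (q i : ZMod p) * (q j : ZMod p)⁻¹ ≠ 0 := fun h0 => hq0 i (by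
      linear_combination (q j : ZMod p) * h0 - (q i : ZMod p) * hinv j)
    have h2 := hsin _ hne
    rw [← div_eq_mul_inv, eq_div_iff (by simp only [hS]; linarith)]
    simp only [hF, hS]
    linarith
  have hsum : ∑ j, F j = 0 := by
    rw [hF, h.sum_addChar hq]
    have := AddChar.sum_mulShift (q i : ZMod p) (ZMod.isPrimitive_stdAddChar p)
    rw [if_neg (hq0 i)] at this
    simpa [mul_comm] using this
  have hFi : F i = -∑ j ∈ Finset.univ.erase i, F j := by
    rw [eq_neg_iff_add_eq_zero, Finset.add_sum_erase _ _ (Finset.mem_univ i), hsum]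
  have hle : ‖F i‖ ≤ ∑ j ∈ Finset.univ.erase i, ‖F j‖ := by
    rw [hFi, norm_neg]
    exact norm_sum_le _ _
  simp only [hnorm, ← Finset.mul_sum] at hle
  have hpos : 0 < S (q i) := by linarith [hsin _ (hq0 i)]
  have := le_of_mul_le_mul_left hle hpos
  have h1 : S ((q i : ZMod p) * (q i : ZMod p)⁻¹) = Real.sin (Real.pi / p) := by
    rw [hinv, hS]
    have : ((1 : ZMod p).valMinAbs).natAbs = 1 := by
      rw [ZMod.valMinAbs_natAbs_eq_min, ZMod.val_one]
      omega
    simp [this]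
  rwa [h1] at this

theorem natAbs_valMinAbs_eq_iff {p : ℕ} [NeZero p] {x y : ZMod p} :
    x.valMinAbs.natAbs = y.valMinAbs.natAbs ↔ x = y ∨ x = -y := by
  constructor
  · intro h
    rcases Int.natAbs_eq_natAbs_iff.1 h with h | h
    · exact Or.inl (ZMod.injective_valMinAbs h)
    · right
      rw [← ZMod.coe_valMinAbs x, h, Int.cast_neg, ZMod.coe_valMinAbs]
  · rintro (rfl | rfl)
    · rfl
    · exact ZMod.natAbs_valMinAbs_neg y

/-- In a disjoint covering system of four sequences, each numerator is up to sign twice another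
one modulo `p`. -/
theorem IsBeattyDCS.exists_eq_two_mul {p : ℕ} (hp : 11 ≤ p) {q : Fin 4 → ℕ} {β : Fin 4 → ℝ}
    (hq : ∀ i, 0 < q i) (hc : ∀ i, Nat.Coprime p (q i)) (hinj : Function.Injective q)
    (h : IsBeattyDCS (fun i => (p : ℝ) / (q i : ℝ)) β) (i : Fin 4) :
    ∃ j, (q i : ZMod p) = 2 * q j ∨ (q i : ZMod p) = -(2 * q j) := by
  have : NeZero p := ⟨by omega⟩
  have hinv : ∀ j, (q j : ZMod p) * (q j : ZMod p)⁻¹ = 1 :=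
    fun j => ZMod.coe_mul_inv_eq_one _ (hc j).symm
  have hsum := h.sum_eq (by omega) hq hc
  rw [Fin.sum_univ_four] at hsum
  -- Two of four positive terms with sum `p`; this excludes `q j ≡ ±q k`.
  have hlt : ∀ j k, j ≠ k → q j + q k < p := by
    have h0 := hq 0; have h1 := hq 1; have h2 := hq 2; have h3 := hq 3
    intro j k hjk
    fin_cases j <;> fin_cases k <;> simp at hjk ⊢ <;> omega
  have hne : ∀ j k, j ≠ k → (q j : ZMod p) ≠ q k := by
    intro j k hjk he
    rw [ZMod.natCast_eq_natCast_iff'] at he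
    have := hlt j k hjk
    rw [Nat.mod_eq_of_lt (by omega), Nat.mod_eq_of_lt (by omega)] at he
    exact hjk (hinj he)
  have hne' : ∀ j k, j ≠ k → (q j : ZMod p) ≠ -q k := by
    intro j k hjk he
    have h0 : ((q j + q k : ℕ) : ZMod p) = 0 := by push_cast; rw [he]; ring
    rw [ZMod.natCast_eq_zero_iff] at h0
    have := Nat.le_of_dvd (by have := hq j; omega) h0
    have := hlt j k hjk
    omega
  by_contra! hno
  set m : Fin 4 → ℕ := fun j => ((q i : ZMod p) * (q j : ZMod p)⁻¹).valMinAbs.natAbs with hm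
  have hmle : ∀ j, m j ≤ p / 2 := fun j => ZMod.natAbs_valMinAbs_le _
  have hcast : ∀ j, (q i : ZMod p) = m j * q j ∨ (q i : ZMod p) = -(m j * q j) := by
    intro j
    have h1 : (q i : ZMod p) = ((q i : ZMod p) * (q j : ZMod p)⁻¹) * q j := by
      linear_combination (-(q i : ZMod p)) * hinv j
    have h2 := ZMod.coe_valMinAbs ((q i : ZMod p) * (q j : ZMod p)⁻¹)
    rcases Int.natAbs_eq ((q i : ZMod p) * (q j : ZMod p)⁻¹).valMinAbs with h3 | h3
    · left
      rw [h3, Int.cast_natCast] at h2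
      rw [hm]; simp only; rw [h2]; exact h1
    · right
      rw [h3, Int.cast_neg, Int.cast_natCast] at h2
      rw [← neg_mul, hm]; simp only; rw [h2]; exact h1
  have hm3 : ∀ j, j ≠ i → 3 ≤ m j := by
    intro j hj
    by_contra hlt3
    have hji := hcast j
    have : m j = 0 ∨ m j = 1 ∨ m j = 2 := by omega
    rcases this with h0 | h0 | h0 <;> rw [h0] at hji
    · have hz : (q i : ZMod p) = 0 := by simpa using hji
      rw [ZMod.natCast_eq_zero_iff] at hz
      exact absurd (Nat.le_of_dvd (hq i) hz) (not_le.2 (h.lt (by omega) hq i))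
    · rcases hji with h1 | h1
      · exact hne i j hj.symm (by simpa using h1)
      · exact hne' i j hj.symm (by simpa using h1)
    · rcases hji with h1 | h1
      · exact (hno j).1 (by simpa using h1)
      · exact (hno j).2 (by simpa using h1)
  have hmne : ∀ j k, j ≠ k → m j ≠ m k := by
    intro j k hjk he
    rcases natAbs_valMinAbs_eq_iff.1 he with h1 | h1
    · exact hne j k hjk (by
        linear_combination (-(q j : ZMod p) * q k * (q i : ZMod p)⁻¹) * h1 +
          ((q k : ZMod p) * q j * (q j : ZMod p)⁻¹ - q j * q k * (q k : ZMod p)⁻¹) * hinv i +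
          (q k : ZMod p) * hinv j - (q j : ZMod p) * hinv k)
    · exact hne' j k hjk (by
        linear_combination ((q j : ZMod p) * q k * (q i : ZMod p)⁻¹) * h1 -
          ((q k : ZMod p) * q j * (q j : ZMod p)⁻¹ + q j * q k * (q k : ZMod p)⁻¹) * hinv i -
          (q k : ZMod p) * hinv j - (q j : ZMod p) * hinv k)
  obtain ⟨a, b, c, hab, hac, hbc, hai, hbi, hci, he⟩ : ∃ a b c : Fin 4, a ≠ b ∧ a ≠ c ∧ b ≠ c ∧
      a ≠ i ∧ b ≠ i ∧ c ≠ i ∧ Finset.univ.erase i = {a, b, c} := by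
    clear * -
    revert i
    decide
  have hle := h.inv_sin_le (by omega) hq hc i
  rw [he, Finset.sum_insert (by simp [hab, hac]), Finset.sum_insert (by simp [hbc]),
    Finset.sum_singleton, ← add_assoc] at hle
  exact absurd hle (not_le.2 (inv_sin_sum_lt hp (hm3 a hai) (hm3 b hbi) (hm3 c hci)
    (hmle a) (hmle b) (hmle c) (hmne a b hab) (hmne a c hac) (hmne b c hbc)))

/-! ### Doubling cycles and the modulus -/

theorem fin_four_exists_periodic (g : Fin 4 → Fin 4) :
    ∃ x, g x = x ∨ g (g x) = x ∨ g (g (g x)) = x ∨ g (g (g (g x))) = x := by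
  revert g
  decide +kernel

/-- A finite doubling orbit up to sign of length at most four forces the modulus. -/
theorem modulus_of_doubling {p : ℕ} (hp : 11 ≤ p) {q : Fin 4 → ℕ}
    (hc : ∀ i, Nat.Coprime p (q i))
    (h : ∀ i, ∃ j, (q i : ZMod p) = 2 * q j ∨ (q i : ZMod p) = -(2 * q j)) : p = 15 ∨ p = 17 := by
  choose g hg using h
  have hdvd : ∀ (x : Fin 4) (k : ℕ), (k : ZMod p) * q x = 0 → p ∣ k := by
    intro x k hk
    refine (hc x).dvd_of_dvd_mul_right ?_
    rw [← ZMod.natCast_eq_zero_iff]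
    exact_mod_cast hk
  have trans : ∀ {x y z : Fin 4} {c d : ZMod p},
      ((q x : ZMod p) = c * q y ∨ (q x : ZMod p) = -(c * q y)) →
      ((q y : ZMod p) = d * q z ∨ (q y : ZMod p) = -(d * q z)) →
      ((q x : ZMod p) = (c * d) * q z ∨ (q x : ZMod p) = -((c * d) * q z)) := by
    rintro x y z c d (h | h) (h' | h') <;> rw [h, h']
    · left; ring
    · right; ring
    · right; ring
    · left; ring
  -- Here `c + 1` is the power `2^l`, so `c` and `c + 2` are `2^l - 1` and `2^l + 1`.
  have fin : ∀ (x : Fin 4) (c : ℕ),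
      ((q x : ZMod p) = ((c + 1 : ℕ) : ZMod p) * q x ∨
        (q x : ZMod p) = -(((c + 1 : ℕ) : ZMod p) * q x)) → p ∣ c ∨ p ∣ c + 2 := by
    rintro x c (h | h)
    · exact Or.inl (hdvd x _ (by push_cast at h ⊢; linear_combination -h))
    · exact Or.inr (hdvd x _ (by push_cast at h ⊢; linear_combination h))
  obtain ⟨x, hx⟩ := fin_four_exists_periodic g
  have key : (p ∣ 1 ∨ p ∣ 3) ∨ (p ∣ 3 ∨ p ∣ 5) ∨ (p ∣ 7 ∨ p ∣ 9) ∨ (p ∣ 15 ∨ p ∣ 17) := by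
    have h1 := hg x
    have h2 := trans h1 (hg (g x))
    have h3 := trans h2 (hg (g (g x)))
    have h4 := trans h3 (hg (g (g (g x))))
    rcases hx with hx | hx | hx | hx
    · rw [hx] at h1
      exact Or.inl (fin x 1 (by push_cast; exact h1))
    · rw [hx] at h2
      refine Or.inr (Or.inl (fin x 3 ?_))
      convert h2 using 3 <;> norm_num
    · rw [hx] at h3
      refine Or.inr (Or.inr (Or.inl (fin x 7 ?_)))
      convert h3 using 3 <;> norm_num
    · rw [hx] at h4
      refine Or.inr (Or.inr (Or.inr (fin x 15 ?_)))
      convert h4 using 3 <;> norm_num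
  have hp' : p ≤ 17 := by
    rcases key with (h | h) | (h | h) | (h | h) | (h | h) <;>
      exact (Nat.le_of_dvd (by norm_num) h).trans (by norm_num)
  clear * - hp hp' key
  revert key
  interval_cases p <;> decide

/-! ### Finite checks for 15 and 17, and the conclusion -/

theorem image_of_sum_eq_fifteen (a b c : Fin 15) (d : ℕ) (hs : a.val + b + c + d = 15)
    (h : Function.Injective ![a.val, b, c, d] ∧ ∀ i, Nat.Coprime 15 (![a.val, b, c, d] i)) :
    Finset.univ.image ![a.val, b, c, d] = {8, 4, 2, 1} := by
  have ha : Nat.Coprime 15 a := h.2 0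
  have hb : Nat.Coprime 15 b := h.2 1
  have hc : Nat.Coprime 15 c := h.2 2
  obtain rfl : d = 15 - (a.val + b + c) := by omega
  replace hs : a.val + b + c ≤ 15 := by omega
  revert h
  -- Cheap conditions precede the costly ones in the decided statement, to prune the search.
  revert ha hb hc
  revert hs
  revert a b c
  decide +kernel

/-- The coefficient 15 stands for `-2` modulo 17. Bounding entries by 15 loses nothing: the other
three distinct positive terms sum to at least 6. -/
theorem not_doubling_of_sum_eq_seventeen (a b c : Fin 15) (d : ℕ) (hs : a.val + b + c + d = 17)
    (h : Function.Injective ![a.val, b, c, d] ∧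
      ∀ i, ∃ j, (![a.val, b, c, d] i + 15 * ![a.val, b, c, d] j) % 17 = 0 ∨
        (![a.val, b, c, d] i + 2 * ![a.val, b, c, d] j) % 17 = 0) : False := by
  have hab : a.val ≠ b := h.1.ne (show (0 : Fin 4) ≠ 1 by decide)
  have hac : a.val ≠ c := h.1.ne (show (0 : Fin 4) ≠ 2 by decide)
  have hbc : b.val ≠ c := h.1.ne (show (1 : Fin 4) ≠ 2 by decide)
  obtain rfl : d = 17 - (a.val + b + c) := by omega
  replace hs : a.val + b + c ≤ 17 := by omega
  revert h
  revert hab hac hbc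
  revert hs
  revert a b c
  decide +kernel

theorem theoremA (p : ℕ) (q : Fin 4 → ℕ) (β : Fin 4 → ℝ)
    (hp : 0 < p) (hq : ∀ i, 0 < q i)
    (hcop : ∀ i, Nat.Coprime p (q i))
    (hdistinct : Function.Injective fun i => (p : ℝ) / (q i : ℝ))
    (hdcs : IsBeattyDCS (fun i => (p : ℝ) / (q i : ℝ)) β) :
    p = 15 ∧ Set.range q = {8, 4, 2, 1} := by
  have hinj : Function.Injective q := fun i j hij => hdistinct (by simp only [hij])
  have hsum := hdcs.sum_eq hp hq hcop
  rw [Fin.sum_univ_four] at hsum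
  have h0 := hq 0; have h1 := hq 1; have h2 := hq 2; have h3 := hq 3
  have n01 := hinj.ne (show (0 : Fin 4) ≠ 1 by decide)
  have n02 := hinj.ne (show (0 : Fin 4) ≠ 2 by decide)
  have n03 := hinj.ne (show (0 : Fin 4) ≠ 3 by decide)
  have n12 := hinj.ne (show (1 : Fin 4) ≠ 2 by decide)
  have n13 := hinj.ne (show (1 : Fin 4) ≠ 3 by decide)
  have n23 := hinj.ne (show (2 : Fin 4) ≠ 3 by decide)
  have hp11 : 11 ≤ p := by
    -- Four distinct positive integers sum to at least 10; coprimality to 10 would make all four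
    -- odd, with sum at least 16.
    have hp10 : p ≠ 10 := by
      rintro rfl
      have odd : ∀ i, q i % 2 = 1 := fun i =>
        Nat.odd_iff.1 (Nat.coprime_two_left.1 ((hcop i).coprime_dvd_left (by norm_num)))
      have o0 := odd 0; have o1 := odd 1; have o2 := odd 2; have o3 := odd 3
      omega
    omega
  have hdbl := hdcs.exists_eq_two_mul hp11 hq hcop hinj
  have hvec : ![q 0, q 1, q 2, q 3] = q := by
    funext i
    fin_cases i <;> rfl
  rcases modulus_of_doubling hp11 hcop hdbl with rfl | rfl
  · refine ⟨rfl, ?_⟩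
    have key := image_of_sum_eq_fifteen ⟨q 0, by omega⟩ ⟨q 1, by omega⟩ ⟨q 2, by omega⟩
      (q 3) hsum
    simp only [hvec] at key
    have := congrArg (fun s : Finset ℕ => (s : Set ℕ)) (key ⟨hinj, hcop⟩)
    simpa using this
  · exfalso
    have key := not_doubling_of_sum_eq_seventeen ⟨q 0, by omega⟩ ⟨q 1, by omega⟩ ⟨q 2, by omega⟩
      (q 3) hsum
    simp only [hvec] at key
    refine key ⟨hinj, fun i => ?_⟩
    obtain ⟨j, hj | hj⟩ := hdbl i
    · refine ⟨j, Or.inl (Nat.mod_eq_zero_of_dvd ((ZMod.natCast_eq_zero_iff _ 17).1 ?_))⟩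
      push_cast
      rw [hj, ← add_mul, show (2 : ZMod 17) + 15 = 0 by decide, zero_mul]
    · refine ⟨j, Or.inr (Nat.mod_eq_zero_of_dvd ((ZMod.natCast_eq_zero_iff _ 17).1 ?_))⟩
      push_cast
      rw [hj]
      ring
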